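/- Let $\mathfrak g$ be a complex simple Lie algebra $\mathfrak{so}(2n+1)$, $\mathfrak{sp}(2n)$ or $\mathfrak{so}(2n)$ of rank $n$, let $N=2n+1$ in the first case and $N=2n$ in the other two, and write $i'=N+1-i$. Let $\varepsilon_1,\dots,\varepsilon_n$ be an orthonormal basis of $\mathfrak h^*$, and for $1\le i\le N$ put $\varepsilon_{i'}=-\varepsilon_i$ (so $\varepsilon_{n+1}=0$ for $\mathfrak{so}(2n+1)$). The simple roots are $\alpha_a=\varepsilon_a-\varepsilon_{a+1}$ for $a<n$, and $\alpha_n=\varepsilon_n$, $2\varepsilon_n$, $\varepsilon_{n-1}+\varepsilon_n$ for $\mathfrak{so}(2n+1)$, $\mathfrak{sp}(2n)$, $\mathfrak{so}(2n)$, respectively; $\rho$ is half the sum of the positive roots. Let $q=e^{\hbar}\in\mathbb C$ be not a root of unity, $q^z=e^{\hbar z}$ and $[z]_q=\frac{q^z-q^{-z}}{q-q^{-1}}$. Let $U_q(\mathfrak g)$ be the quantum group with generators $e_{\pm\alpha}$, $q^{\pm h_\alpha}$ ($\alpha$ simple), subject to the $q$-Serre relations and $$q^{h_\alpha}e_{\pm\beta}q^{-h_\alpha}=q^{\pm(\alpha,\beta)}e_{\pm\beta},\qquad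 [e_\alpha,e_{-\beta}]=\delta_{\alpha\beta}\frac{[h_\alpha]_q}{[(\alpha,\alpha)/2]_q},$$ the $q^{h_\alpha}$ being commuting and invertible, with comultiplication $$\Delta(e_\alpha)=e_\alpha\otimes 1+q^{h_\alpha}\otimes e_\alpha,\quad \Delta(e_{-\alpha})=e_{-\alpha}\otimes q^{-h_\alpha}+1\otimes e_{-\alpha},\quad \Delta(q^{\pm h_\alpha})=q^{\pm h_\alpha}\otimes q^{\pm h_\alpha}.$$ Put $e_a=e_{\alpha_a}$ and $f_a=e_{-\alpha_a}$, except that $f_n=[\tfrac12]_q\,e_{-\alpha_n}$ for $\mathfrak{so}(2n+1)$. The natural representation on $\mathbb C^N$ with standard basis $w_1,\dots,w_N$ is given by $e_a\mapsto\sum e_{lr}$ and $f_a\mapsto\sum e_{rl}$, both sums over all pairs $(l,r)$ with $\varepsilon_l-\varepsilon_r=\alpha_a$ (here $e_{lr}$ are the matrix units), and $q^{h_\alpha}w_i=q^{(\alpha,\varepsilon_i)}w_i$. Write $i\prec j$ if $i\ne j$ and there is a Chevalley monomial $\psi_{ji}=f_{a_1}\cdots f_{a_m}$ such that $\psi_{ji}w_i=c\,w_j$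 with $c\neq0$. For any such monomial, let $\psi^{ij}=f_{a_m}\cdots f_{a_1}$ (the principal monomial, with the factors of $\psi_{ji}$ in the reverse order) and let $\|i-j\|=m$ be the number of factors. For a weight $\lambda\in\mathfrak h^*$ let $M_\lambda$ be the Verma module over $U_q(\mathfrak g)$ with highest weight vector $v_\lambda$, so that $e_\alpha v_\lambda=0$ and $q^{\pm h_\alpha}v_\lambda=q^{\pm(\lambda,\alpha)}v_\lambda$ for all simple $\alpha$. Let $V_m\subset\mathbb C^N\otimes M_\lambda$ be the $U_q(\mathfrak g)$-submodule generated by $w_k\otimes v_\lambda$, $k\le m$ (with $V_0=0$). **Proposition.** For all $i\prec j$, $$w_i\otimes\psi^{ij}v_\lambda\;\equiv\;(-1)^{\|i-j\|}\,q^{-(\lambda+\rho,\;\varepsilon_i-\varepsilon_j)+\frac12\|\varepsilon_i-\varepsilon_j\|^2}\;w_j\otimes v_\lambda \pmod{V_{j-1}}.$$ -/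

import Mathlib

open scoped TensorProduct

/-- The series of the orthosymplectic simple Lie algebras:
`B` is `so(2n+1)`, `C` is `sp(2n)`, `D` is `so(2n)`. -/
inductive OSType : Type
  | B
  | C
  | D

namespace OSType

/-- The dimension `N` of the natural representation. -/
def dim : OSType → ℕ → ℕ
  | B, n => 2 * n + 1
  | C, n => 2 * n
  | D, n => 2 * n

/-- The ranks `n` for which `so(2n+1)`, `sp(2n)`, `so(2n)` is a simple Lie algebra of rank `n`
(`so(2)` and `so(4)` are not simple). -/
def IsSimpleRank : OSType → ℕ → Prop
  | B, n => 1 ≤ n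
  | C, n => 1 ≤ n
  | D, n => 3 ≤ n

end OSType

noncomputable section

/-! ### Weights

A weight is written in the orthonormal basis `ε_1, …, ε_n` of the dual Cartan subalgebra.
All indices are counted from `0`: `ε_{a+1}` has index `a : Fin n`, and `w_{i+1}` has index
`i : Fin N`, so that `i' = N + 1 - i` becomes `Fin.rev i`. -/

/-- The weight `ε_i` of the basis vector `w_i` of `ℂ^N`; thus `ε_{i'} = -ε_i`
(and `ε_{n+1} = 0` for `so(2n+1)`). -/
def wtEps (T : OSType) (n : ℕ) (i : Fin (T.dim n)) : Fin n → ℤ := fun a =>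
  if i.val = a.val then 1 else if (Fin.rev i).val = a.val then -1 else 0

/-- The simple roots: `α_a = ε_a - ε_{a+1}` for `a < n`, and `α_n` is `ε_n`, `2ε_n`, `ε_{n-1}+ε_n`
in the types `B`, `C`, `D` respectively. -/
def simpleRoot (T : OSType) (n : ℕ) (a : Fin n) : Fin n → ℤ := fun b =>
  if a.val + 1 < n then
    (if b = a then 1 else if b.val = a.val + 1 then -1 else 0)
  else
    match T with
    | .B => if b = a then 1 else 0
    | .C => if b = a then 2 else 0
    | .D => if b = a ∨ b.val + 1 = a.val then 1 else 0

/-- The inner product of integral weights. -/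
def intPair {n : ℕ} (μ ν : Fin n → ℤ) : ℤ := ∑ a, μ a * ν a

/-- The inner product of a complex weight with an integral weight. -/
def wtPair {n : ℕ} (lam : Fin n → ℂ) (μ : Fin n → ℤ) : ℂ := ∑ a, lam a * (μ a : ℂ)

/-- The Weyl vector: half the sum of the positive roots, which are `ε_b - ε_c` and `ε_b + ε_c` for
`b < c`, together with all `ε_b` (type `B`) or all `2ε_b` (type `C`). -/
def weylVector (T : OSType) (n : ℕ) : Fin n → ℂ :=
  let e : Fin n → Fin n → ℂ := fun b => Pi.single b 1
  (1 / 2 : ℂ) •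
    ((∑ b, ∑ c, if b < c then (e b - e c) + (e b + e c) else 0) +
      ∑ b, match T with
        | .B => e b
        | .C => (2 : ℂ) • e b
        | .D => 0)

/-! ### Quantum numbers, with `q = exp ℏ` -/

/-- `q ^ z = exp (ℏ z)`. -/
def qPow (hbar z : ℂ) : ℂ := Complex.exp (hbar * z)

/-- `[z]_q = (q^z - q^{-z}) / (q - q^{-1})`. -/
def qNum (hbar z : ℂ) : ℂ :=
  (qPow hbar z - qPow hbar (-z)) / (qPow hbar 1 - qPow hbar (-1))

/-- The factorial `[m]!` of the quantum integers `[k] = [k]_p` in the base `p = q^d`. -/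
def qFactorial (hbar d : ℂ) (m : ℕ) : ℂ := ∏ k ∈ Finset.range m, qNum (hbar * d) ((k : ℂ) + 1)

/-- The Gaussian binomial coefficient in the base `p = q^d`. -/
def qBinom (hbar d : ℂ) (m r : ℕ) : ℂ :=
  qFactorial hbar d m / (qFactorial hbar d r * qFactorial hbar d (m - r))

/-! ### The quantum group -/

/-- Chevalley generators: `e a` is `e_{α_a}`, `f a` is the normalized negative generator `f_a`,
`k a` is `q^{h_{α_a}}` and `kinv a` is `q^{-h_{α_a}}`. -/
inductive UqGen (n : ℕ) : Type
  | e (a : Fin n)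
  | f (a : Fin n)
  | k (a : Fin n)
  | kinv (a : Fin n)

/-- Half of the squared length, `(α_a, α_a) / 2`. -/
def halfNorm (T : OSType) (n : ℕ) (a : Fin n) : ℂ :=
  (intPair (simpleRoot T n a) (simpleRoot T n a) : ℂ) / 2

/-- The normalization `f_a = fScale • e_{-α_a}`: it is `[1/2]_q` for the short simple root
of `so(2n+1)` and `1` in all other cases. -/
def fScale (T : OSType) (n : ℕ) (hbar : ℂ) (a : Fin n) : ℂ :=
  match T with
  | .B => if a.val + 1 = n then qNum hbar (1 / 2) else 1
  | .C => 1
  | .D => 1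

/-- `1 - a_{ab}`, where `a_{ab} = 2 (α_a, α_b) / (α_a, α_a)` is the Cartan integer. -/
def serreExp (T : OSType) (n : ℕ) (a b : Fin n) : ℕ :=
  (1 - 2 * intPair (simpleRoot T n a) (simpleRoot T n b) /
    intPair (simpleRoot T n a) (simpleRoot T n a)).toNat

/-- The `q`-Serre polynomial in two elements of an algebra: the base is `q^{(α_a, α_a)/2}` and the
degree in the first element is `m`. -/
def serrePoly {A : Type} [Ring A] [Algebra ℂ A] (hbar d : ℂ) (m : ℕ) (x y : A) : A :=
  ∑ r ∈ Finset.range (m + 1), ((-1 : ℂ) ^ r * qBinom hbar d m r) • (x ^ (m - r) * y * x ^ r)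

/-- The defining relations of `U_q(g)`. -/
inductive UqRel (T : OSType) (n : ℕ) (hbar : ℂ) :
    FreeAlgebra ℂ (UqGen n) → FreeAlgebra ℂ (UqGen n) → Prop
  | k_kinv (a : Fin n) :
      UqRel T n hbar (FreeAlgebra.ι ℂ (.k a) * FreeAlgebra.ι ℂ (.kinv a)) 1
  | kinv_k (a : Fin n) :
      UqRel T n hbar (FreeAlgebra.ι ℂ (.kinv a) * FreeAlgebra.ι ℂ (.k a)) 1
  | k_comm (a b : Fin n) :
      UqRel T n hbar (FreeAlgebra.ι ℂ (.k a) * FreeAlgebra.ι ℂ (.k b))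
        (FreeAlgebra.ι ℂ (.k b) * FreeAlgebra.ι ℂ (.k a))
  | k_e (a b : Fin n) :
      UqRel T n hbar
        (FreeAlgebra.ι ℂ (.k a) * FreeAlgebra.ι ℂ (.e b) * FreeAlgebra.ι ℂ (.kinv a))
        (qPow hbar (intPair (simpleRoot T n a) (simpleRoot T n b)) • FreeAlgebra.ι ℂ (.e b))
  | k_f (a b : Fin n) :
      UqRel T n hbar
        (FreeAlgebra.ι ℂ (.k a) * FreeAlgebra.ι ℂ (.f b) * FreeAlgebra.ι ℂ (.kinv a))
        (qPow hbar (-(intPair (simpleRoot T n a) (simpleRoot T n b) : ℂ)) •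
          FreeAlgebra.ι ℂ (.f b))
  /-- `[e_α, e_{-α}] = [h_α]_q / [(α,α)/2]_q`, rescaled from `e_{-α}` to `f`. -/
  | e_f_same (a : Fin n) :
      UqRel T n hbar
        (FreeAlgebra.ι ℂ (.e a) * FreeAlgebra.ι ℂ (.f a) -
          FreeAlgebra.ι ℂ (.f a) * FreeAlgebra.ι ℂ (.e a))
        ((fScale T n hbar a /
            ((qPow hbar 1 - qPow hbar (-1)) * qNum hbar (halfNorm T n a))) •
          (FreeAlgebra.ι ℂ (.k a) - FreeAlgebra.ι ℂ (.kinv a)))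
  | e_f_diff (a b : Fin n) (hab : a ≠ b) :
      UqRel T n hbar (FreeAlgebra.ι ℂ (.e a) * FreeAlgebra.ι ℂ (.f b))
        (FreeAlgebra.ι ℂ (.f b) * FreeAlgebra.ι ℂ (.e a))
  | serre_e (a b : Fin n) (hab : a ≠ b) :
      UqRel T n hbar
        (serrePoly hbar (halfNorm T n a) (serreExp T n a b)
          (FreeAlgebra.ι ℂ (.e a)) (FreeAlgebra.ι ℂ (.e b))) 0
  | serre_f (a b : Fin n) (hab : a ≠ b) :
      UqRel T n hbar
        (serrePoly hbar (halfNorm T n a) (serreExp T n a b)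
          (FreeAlgebra.ι ℂ (.f a)) (FreeAlgebra.ι ℂ (.f b))) 0

/-- The quantum group `U_q(g)`, `q = exp ℏ`. -/
abbrev Uq (T : OSType) (n : ℕ) (hbar : ℂ) : Type := RingQuot (UqRel T n hbar)

/-- The class of a generator in `U_q(g)`. -/
def uqOf (T : OSType) (n : ℕ) (hbar : ℂ) (x : UqGen n) : Uq T n hbar :=
  RingQuot.mkAlgHom ℂ (UqRel T n hbar) (FreeAlgebra.ι ℂ x)

/-- The Chevalley monomial `f_{a_1} ⋯ f_{a_m}` of a word `a_1, …, a_m`. -/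
def uqMonomial (T : OSType) (n : ℕ) (hbar : ℂ) (l : List (Fin n)) : Uq T n hbar :=
  (l.map fun a => uqOf T n hbar (.f a)).prod

/-! ### Verma modules -/

/-- The left ideal generated by all `e_α` and all `q^{h_α} - q^{(λ,α)}`, `α` simple. -/
def vermaIdeal (T : OSType) (n : ℕ) (hbar : ℂ) (lam : Fin n → ℂ) :
    Submodule (Uq T n hbar) (Uq T n hbar) :=
  Submodule.span (Uq T n hbar)
    ((Set.range fun a : Fin n => uqOf T n hbar (.e a)) ∪
      Set.range fun a : Fin n => uqOf T n hbar (.k a) -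
        algebraMap ℂ (Uq T n hbar) (qPow hbar (wtPair lam (simpleRoot T n a))))

/-- The Verma module `M_λ = U_q(g) ⊗_{U_q(b_+)} ℂ_λ`, as the quotient of `U_q(g)` by the left ideal
that annihilates the highest weight vector. -/
abbrev Verma (T : OSType) (n : ℕ) (hbar : ℂ) (lam : Fin n → ℂ) : Type :=
  Uq T n hbar ⧸ vermaIdeal T n hbar lam

/-- The canonical generator `v_λ`. -/
def vermaVec (T : OSType) (n : ℕ) (hbar : ℂ) (lam : Fin n → ℂ) : Verma T n hbar lam :=
  Submodule.Quotient.mk 1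

/-- The action of an element of `U_q(g)` on `M_λ`. -/
def vermaAct (T : OSType) (n : ℕ) (hbar : ℂ) (lam : Fin n → ℂ) (u : Uq T n hbar) :
    Module.End ℂ (Verma T n hbar lam) :=
  Algebra.lsmul ℂ ℂ (Verma T n hbar lam) u

/-! ### The natural representation -/

/-- The basis vector `w_i` of `ℂ^N`. -/
def natVec (T : OSType) (n : ℕ) (i : Fin (T.dim n)) : Fin (T.dim n) → ℂ := Pi.single i 1

/-- The natural representation `π` on the Chevalley generators. With
`P(α) = {(l, r) | ε_l - ε_r = α}`, one has `π(e_α) = ∑ e_{lr}` and `π(f_α) = ∑ e_{rl}` over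
`(l, r) ∈ P(α)`, and `q^{h_α}` multiplies `w_i` by `q^{(α, ε_i)}`. -/
def natMat (T : OSType) (n : ℕ) (hbar : ℂ) :
    UqGen n → Matrix (Fin (T.dim n)) (Fin (T.dim n)) ℂ
  | .e a => Matrix.of fun l r => if wtEps T n l - wtEps T n r = simpleRoot T n a then 1 else 0
  | .f a => Matrix.of fun r l => if wtEps T n l - wtEps T n r = simpleRoot T n a then 1 else 0
  | .k a => Matrix.diagonal fun i => qPow hbar (intPair (simpleRoot T n a) (wtEps T n i))
  | .kinv a => Matrix.diagonal fun i => qPow hbar (-(intPair (simpleRoot T n a) (wtEps T n i) : ℂ))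

/-- `π` of a generator as a linear operator. -/
def natAct (T : OSType) (n : ℕ) (hbar : ℂ) (x : UqGen n) : Module.End ℂ (Fin (T.dim n) → ℂ) :=
  Matrix.toLin' (natMat T n hbar x)

/-- The Chevalley monomial `ψ = f_{a_1} ⋯ f_{a_m}` satisfies `ψ w_i = w_j` up to an invertible
scalar, i.e. (read from right to left) it is a path from `w_i` to `w_j` in the representation
diagram. Then `ψ = ψ_{ji}`, the principal monomial `ψ^{ij}` is the product of the same factors in
the reverse order, and the length `m` of the word is the distance from `i` to `j`. -/
def IsChevalleyPath (T : OSType) (n : ℕ) (hbar : ℂ) (l : List (Fin n)) (i j : Fin (T.dim n)) :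
    Prop :=
  ∃ c : ℂ, c ≠ 0 ∧ (l.map fun a => natAct T n hbar (.f a)).prod (natVec T n i) = c • natVec T n j

/-- The strict part of the partial order: `i ≺ j`. -/
def IsPrec (T : OSType) (n : ℕ) (hbar : ℂ) (i j : Fin (T.dim n)) : Prop :=
  (∃ l : List (Fin n), IsChevalleyPath T n hbar l i j) ∧ i ≠ j

/-! ### The tensor product and its standard filtration -/

/-- The action of the generators on `ℂ^N ⊗ M_λ` through the comultiplication
`Δ(e_α) = e_α ⊗ 1 + q^{h_α} ⊗ e_α`, `Δ(f_α) = f_α ⊗ q^{-h_α} + 1 ⊗ f_α`,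
`Δ(q^{±h_α}) = q^{±h_α} ⊗ q^{±h_α}`. -/
def tensorGen (T : OSType) (n : ℕ) (hbar : ℂ) (lam : Fin n → ℂ) :
    UqGen n → Module.End ℂ ((Fin (T.dim n) → ℂ) ⊗[ℂ] Verma T n hbar lam)
  | .e a =>
      TensorProduct.map (natAct T n hbar (.e a)) LinearMap.id +
        TensorProduct.map (natAct T n hbar (.k a)) (vermaAct T n hbar lam (uqOf T n hbar (.e a)))
  | .f a =>
      TensorProduct.map (natAct T n hbar (.f a))
          (vermaAct T n hbar lam (uqOf T n hbar (.kinv a))) +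
        TensorProduct.map LinearMap.id (vermaAct T n hbar lam (uqOf T n hbar (.f a)))
  | .k a =>
      TensorProduct.map (natAct T n hbar (.k a)) (vermaAct T n hbar lam (uqOf T n hbar (.k a)))
  | .kinv a =>
      TensorProduct.map (natAct T n hbar (.kinv a))
        (vermaAct T n hbar lam (uqOf T n hbar (.kinv a)))

/-- The action on `ℂ^N ⊗ M_λ` of the (noncommutative) polynomials in the Chevalley generators;
every element of `U_q(g)` is the class of such a polynomial. -/
def tensorAct (T : OSType) (n : ℕ) (hbar : ℂ) (lam : Fin n → ℂ) :
    FreeAlgebra ℂ (UqGen n) →ₐ[ℂ]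
      Module.End ℂ ((Fin (T.dim n) → ℂ) ⊗[ℂ] Verma T n hbar lam) :=
  FreeAlgebra.lift ℂ (tensorGen T n hbar lam)

/-- The term `V_m` of the standard filtration: the `U_q(g)`-submodule of `ℂ^N ⊗ M_λ` generated by
`w_k ⊗ v_λ` for the first `m` basis vectors `w_k`. -/
def stdFiltration (T : OSType) (n : ℕ) (hbar : ℂ) (lam : Fin n → ℂ) (m : ℕ) :
    Submodule ℂ ((Fin (T.dim n) → ℂ) ⊗[ℂ] Verma T n hbar lam) :=
  Submodule.span ℂ
    {y | ∃ (x : FreeAlgebra ℂ (UqGen n)) (k : Fin (T.dim n)), k.val < m ∧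
      y = tensorAct T n hbar lam x (natVec T n k ⊗ₜ[ℂ] vermaVec T n hbar lam)}

/-- The exponent `(λ + ρ, ε_i - ε_j) - ‖ε_i - ε_j‖² / 2`. -/
def thetaExp (T : OSType) (n : ℕ) (lam : Fin n → ℂ) (i j : Fin (T.dim n)) : ℂ :=
  wtPair (lam + weylVector T n) (wtEps T n i - wtEps T n j) -
    (intPair (wtEps T n i - wtEps T n j) (wtEps T n i - wtEps T n j) : ℂ) / 2

end

/-! ### Weights and the height functional -/

/-! The coproduct of `f_a`, solved for its second summand, gives w ⊗ f_a x = Δ(f_a)(w ⊗ x) - f_a w ⊗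
q^{-h_a} x. If the path from w_i to w_j starts with f_a w_i = w_r, then f_a is the leftmost factor
of the principal monomial: ψ^{ij} = f_a ψ^{rj}. Take w = w_i and x = ψ^{rj} v_λ. The last term is a
power of q times w_r ⊗ ψ^{rj} v_λ, which is handled by induction on the path and contributes one
factor -1.

The first term vanishes modulo V_{j-1} (`stdFiltration` at `j.val`, as indices start at 0). Indeed
w_i ⊗ ψ^{rj} v_λ has weight λ + ε_j + α_a, which is too high: by
`natVec_tmul_uqMonomial_mem_stdFiltration`, a vector w_k ⊗ ψ v_λ whose weight has height above that
of λ + ε_j lies in V_{j-1}.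

The powers of q multiply to the stated one by `thetaExp_eq_add`, where ρ enters through (ρ, α) = (α,
α)/2. -/

lemma intPair_add {n : ℕ} (g μ ν : Fin n → ℤ) :
    intPair g (μ + ν) = intPair g μ + intPair g ν := by
  simp [intPair, mul_add, Finset.sum_add_distrib]

lemma intPair_sub {n : ℕ} (g μ ν : Fin n → ℤ) :
    intPair g (μ - ν) = intPair g μ - intPair g ν := by
  simp [intPair, mul_sub, Finset.sum_sub_distrib]

lemma intPair_comm {n : ℕ} (μ ν : Fin n → ℤ) : intPair μ ν = intPair ν μ := by
  simp [intPair, mul_comm]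

lemma intPair_single {n : ℕ} (g : Fin n → ℤ) (a : Fin n) (z : ℤ) :
    intPair g (Pi.single a z) = g a * z := by
  simp [intPair, Pi.single_apply]

lemma wtPair_add_left {n : ℕ} (lam lam' : Fin n → ℂ) (μ : Fin n → ℤ) :
    wtPair (lam + lam') μ = wtPair lam μ + wtPair lam' μ := by
  simp [wtPair, add_mul, Finset.sum_add_distrib]

lemma wtPair_add {n : ℕ} (lam : Fin n → ℂ) (μ ν : Fin n → ℤ) :
    wtPair lam (μ + ν) = wtPair lam μ + wtPair lam ν := by
  simp [wtPair, mul_add, Finset.sum_add_distrib]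

lemma wtPair_sub {n : ℕ} (lam : Fin n → ℂ) (μ ν : Fin n → ℤ) :
    wtPair lam (μ - ν) = wtPair lam μ - wtPair lam ν := by
  simp [wtPair, mul_sub, Finset.sum_sub_distrib]

lemma wtPair_single {n : ℕ} (lam : Fin n → ℂ) (a : Fin n) (z : ℤ) :
    wtPair lam (Pi.single a z) = lam a * z := by
  simp [wtPair, Pi.single_apply]

lemma simpleRoot_of_lt (T : OSType) {n : ℕ} {a : Fin n} (h : a.val + 1 < n) :
    simpleRoot T n a = Pi.single a 1 - Pi.single ⟨a.val + 1, h⟩ 1 := by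
  funext b
  have h1 : b = a ↔ b.val = a.val := Fin.ext_iff
  have h2 : b = ⟨a.val + 1, h⟩ ↔ b.val = a.val + 1 := Fin.ext_iff
  simp only [simpleRoot, h, if_true, Pi.sub_apply, Pi.single_apply, h1, h2]
  split_ifs <;> first | rfl | omega

lemma simpleRoot_B_last {n : ℕ} {a : Fin n} (h : ¬ a.val + 1 < n) :
    simpleRoot .B n a = Pi.single a 1 := by
  funext b
  simp [simpleRoot, h, Pi.single_apply]

lemma simpleRoot_C_last {n : ℕ} {a : Fin n} (h : ¬ a.val + 1 < n) :
    simpleRoot .C n a = Pi.single a 2 := by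
  funext b
  simp [simpleRoot, h, Pi.single_apply]

/-- Positivity of `a.val` is essential: at 0 the truncated `a.val - 1` would be `a` itself and the
right side would double. -/
lemma simpleRoot_D_last {n : ℕ} {a : Fin n} (h : ¬ a.val + 1 < n) (h0 : 0 < a.val) :
    simpleRoot .D n a = Pi.single a 1 + Pi.single ⟨a.val - 1, by omega⟩ 1 := by
  funext b
  have h1 : b = a ↔ b.val = a.val := Fin.ext_iff
  have h2 : b = (⟨a.val - 1, by omega⟩ : Fin n) ↔ b.val = a.val - 1 := Fin.ext_iff
  simp only [simpleRoot, h, if_false, Pi.add_apply, Pi.single_apply, h1, h2]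
  split_ifs <;> first | rfl | omega

lemma weylVector_apply (T : OSType) (n : ℕ) (a : Fin n) :
    weylVector T n a = (n : ℂ) - 1 - a.val +
      (match T with | .B => 1 / 2 | .C => 1 | .D => 0) := by
  have h1 : (∑ b : Fin n, ∑ c : Fin n, if b < c then
      ((Pi.single b 1 : Fin n → ℂ) - (Pi.single c 1 : Fin n → ℂ)) +
        ((Pi.single b 1 : Fin n → ℂ) + (Pi.single c 1 : Fin n → ℂ)) else 0) a =
      2 * ((n : ℂ) - 1 - a.val) := by
    -- Each pair b < c contributes 2ε_b, so coordinate a counts the indices c > a twice.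
    have key : ∀ b c : Fin n, ((if b < c then
      ((Pi.single b 1 : Fin n → ℂ) - (Pi.single c 1 : Fin n → ℂ)) +
        ((Pi.single b 1 : Fin n → ℂ) + (Pi.single c 1 : Fin n → ℂ)) else 0) : Fin n → ℂ) a =
        if a = b then (if a < c then 2 else 0) else 0 := by
      intro b c
      by_cases hab : a = b
      · subst hab
        by_cases hac : a < c
        · simp only [hac, if_true, Pi.add_apply, Pi.sub_apply, Pi.single_eq_same]
          ring
        · simp [hac]
      · split_ifs <;> simp [hab]
    simp only [Finset.sum_apply, key]
    rw [Finset.sum_comm]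
    simp only [Finset.sum_ite_eq, Finset.mem_univ, if_true]
    rw [← Finset.sum_filter, Finset.sum_const,
      show (Finset.univ.filter fun c => a < c) = Finset.Ioi a by ext; simp, Fin.card_Ioi]
    have : ((n - 1 - a.val : ℕ) : ℂ) = (n : ℂ) - 1 - a.val := by
      have := a.isLt
      rw [Nat.cast_sub (by omega), Nat.cast_sub (by omega)]; simp
    rw [nsmul_eq_mul, this]; ring
  simp only [weylVector, Pi.smul_apply, Pi.add_apply, h1]
  cases T <;> simp [Finset.sum_apply, Pi.single_apply] <;> ring

/-- `(ρ, α) = (α, α) / 2` for a simple root `α`. -/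
lemma wtPair_weylVector_simpleRoot {T : OSType} {n : ℕ} (hn : T.IsSimpleRank n) (a : Fin n) :
    wtPair (weylVector T n) (simpleRoot T n a) =
      (intPair (simpleRoot T n a) (simpleRoot T n a) : ℂ) / 2 := by
  by_cases h : a.val + 1 < n
  · have hne : a ≠ ⟨a.val + 1, h⟩ := by simp [Fin.ext_iff]
    rw [simpleRoot_of_lt T h, wtPair_sub, intPair_sub]
    simp only [wtPair_single, intPair_single, weylVector_apply]
    simp [hne, hne.symm]
  · have hlast : (n : ℂ) = a.val + 1 := by
      have : n = a.val + 1 := by omega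
      exact_mod_cast this
    cases T with
    | B =>
      rw [simpleRoot_B_last h]
      simp [wtPair_single, intPair_single, weylVector_apply, hlast]
    | C =>
      rw [simpleRoot_C_last h]
      simp [wtPair_single, intPair_single, weylVector_apply, hlast]
      norm_num
    | D =>
      have hn3 : 3 ≤ n := hn
      have h0 : 0 < a.val := by omega
      have hne : a ≠ ⟨a.val - 1, by omega⟩ := by simp [Fin.ext_iff]; omega
      have hc : ((a.val - 1 : ℕ) : ℂ) = a.val - 1 := by
        rw [Nat.cast_sub (by omega)]; simp
      rw [simpleRoot_D_last h h0, wtPair_add, intPair_add]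
      simp only [wtPair_single, intPair_single, weylVector_apply]
      simp [hne, hne.symm, hlast, hc]

/-- The functional `ε_b ↦ n + 1 - b`, which is positive on the simple roots and strictly monotone
on the weights of the natural representation. -/
def heightFunctional (n : ℕ) (μ : Fin n → ℤ) : ℤ := intPair (fun a => (n : ℤ) - a.val) μ

lemma heightFunctional_simpleRoot_pos {T : OSType} {n : ℕ} (hn : T.IsSimpleRank n) (a : Fin n) :
    0 < heightFunctional n (simpleRoot T n a) := by
  unfold heightFunctional
  by_cases h : a.val + 1 < n
  · rw [simpleRoot_of_lt T h, intPair_sub, intPair_single, intPair_single]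
    push_cast
    omega
  · cases T with
    | B => rw [simpleRoot_B_last h, intPair_single]; omega
    | C => rw [simpleRoot_C_last h, intPair_single]; omega
    | D =>
      have hn3 : 3 ≤ n := hn
      rw [simpleRoot_D_last h (by omega), intPair_add, intPair_single, intPair_single]
      simp only
      omega

/-- The cases are ε_b, -ε_b, and the zero weight in the middle of type `B`; the second formula
covers the last two. -/
lemma heightFunctional_wtEps (T : OSType) (n : ℕ) (i : Fin (T.dim n)) :
    heightFunctional n (wtEps T n i) =
      if i.val < n then (n : ℤ) - i.val else (T.dim n : ℤ) - 1 - i.val - n := by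
  have hi := i.isLt
  have hr : (Fin.rev i).val = T.dim n - (i.val + 1) := Fin.val_rev i
  have hN : T.dim n = 2 * n ∨ T.dim n = 2 * n + 1 := by cases T <;> simp [OSType.dim]
  unfold heightFunctional
  split_ifs with h
  · rw [show wtEps T n i = Pi.single ⟨i.val, h⟩ 1 from ?_, intPair_single]
    · simp
    · funext b
      have h1 : b = ⟨i.val, h⟩ ↔ b.val = i.val := Fin.ext_iff
      have := b.isLt
      simp only [wtEps, Pi.single_apply, h1, hr]
      split_ifs <;> first | rfl | omega
  · by_cases h' : (Fin.rev i).val < n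
    · rw [show wtEps T n i = Pi.single ⟨(Fin.rev i).val, h'⟩ (-1) from ?_, intPair_single]
      · simp only [hr]; omega
      · funext b
        have h1 : b = ⟨(Fin.rev i).val, h'⟩ ↔ b.val = (Fin.rev i).val := Fin.ext_iff
        have := b.isLt
        simp only [wtEps, Pi.single_apply, h1]
        split_ifs <;> first | rfl | omega
    · rw [show wtEps T n i = 0 from ?_]
      · simp [intPair]; omega
      · funext b
        have := b.isLt
        simp only [wtEps, Pi.zero_apply]
        split_ifs <;> first | rfl | omega

/-- This is why the height is not the pairing with ρ: in type `D` that pairing vanishes on both ε_n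
and -ε_n. -/
lemma heightFunctional_wtEps_strictAnti (T : OSType) (n : ℕ) :
    StrictAnti fun i : Fin (T.dim n) => heightFunctional n (wtEps T n i) := by
  intro i j hij
  have hij' : i.val < j.val := hij
  have hj := j.isLt
  have hN : T.dim n = 2 * n ∨ T.dim n = 2 * n + 1 := by cases T <;> simp [OSType.dim]
  simp only [heightFunctional_wtEps]
  split_ifs <;> omega

lemma wtEps_injective (T : OSType) (n : ℕ) : Function.Injective (wtEps T n) := fun _ _ h =>
  (heightFunctional_wtEps_strictAnti T n).injective (congrArg (heightFunctional n) h)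

/-! ### Paths in the natural representation -/

/-- The weights of ℂ^N are multiplicity free, so each column of the matrix of `f_a` has at most one
nonzero entry. -/
lemma natAct_f_natVec (T : OSType) (n : ℕ) (hbar : ℂ) (a : Fin n) (i : Fin (T.dim n)) :
    natAct T n hbar (.f a) (natVec T n i) = 0 ∨
      ∃ r, natAct T n hbar (.f a) (natVec T n i) = natVec T n r ∧
        wtEps T n i = simpleRoot T n a + wtEps T n r := by
  have hcol : ∀ s, natAct T n hbar (.f a) (natVec T n i) s =
      if wtEps T n i - wtEps T n s = simpleRoot T n a then 1 else 0 := by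
    intro s
    simp [natAct, natVec, natMat]
  by_cases h : ∃ r, wtEps T n i - wtEps T n r = simpleRoot T n a
  · obtain ⟨r, hr⟩ := h
    refine Or.inr ⟨r, ?_, by rw [← hr]; abel⟩
    funext s
    rw [hcol, natVec, Pi.single_apply, ← hr]
    refine if_congr ⟨fun e => ?_, fun e => by rw [e]⟩ rfl rfl
    exact wtEps_injective T n (sub_right_injective e)
  · refine Or.inl (funext fun s => ?_)
    rw [hcol, if_neg fun e => h ⟨s, e⟩]
    rfl

lemma isChevalleyPath_nil {T : OSType} {n : ℕ} {hbar : ℂ} {i j : Fin (T.dim n)}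
    (h : IsChevalleyPath T n hbar [] i j) : i = j := by
  obtain ⟨c, -, h⟩ := h
  by_contra hij
  have := congrFun h i
  simp [natVec, hij] at this

/-- The rightmost letter acts first, so removing it leaves a path starting one step further along.
This drives the main induction. -/
lemma isChevalleyPath_append_singleton {T : OSType} {n : ℕ} {hbar : ℂ} {l : List (Fin n)}
    {a : Fin n} {i j : Fin (T.dim n)} (h : IsChevalleyPath T n hbar (l ++ [a]) i j) :
    ∃ r, natAct T n hbar (.f a) (natVec T n i) = natVec T n r ∧
      wtEps T n i = simpleRoot T n a + wtEps T n r ∧ IsChevalleyPath T n hbar l r j := by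
  obtain ⟨c, hc, h⟩ := h
  simp only [List.map_append, List.map_cons, List.map_nil, List.prod_append, List.prod_cons,
    List.prod_nil, mul_one, Module.End.mul_apply] at h
  rcases natAct_f_natVec T n hbar a i with h0 | ⟨r, hr, hw⟩
  · rw [h0, map_zero] at h
    have := congrFun h j
    simp [natVec, hc.symm] at this
  · exact ⟨r, hr, hw, c, hc, hr ▸ h⟩

lemma wtEps_eq_of_isChevalleyPath {T : OSType} {n : ℕ} {hbar : ℂ} {j : Fin (T.dim n)}
    (l : List (Fin n)) : ∀ {i : Fin (T.dim n)}, IsChevalleyPath T n hbar l i j →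
      wtEps T n i = (l.map (simpleRoot T n)).sum + wtEps T n j := by
  induction l using List.reverseRecOn with
  | nil => intro i h; simp [isChevalleyPath_nil h]
  | append_singleton l a ih =>
    intro i h
    obtain ⟨r, -, hw, hp⟩ := isChevalleyPath_append_singleton h
    rw [hw, ih hp]
    simp
    abel

/-! ### Weight vectors of the Verma module -/

lemma qPow_add (hbar x y : ℂ) : qPow hbar (x + y) = qPow hbar x * qPow hbar y := by
  simp [qPow, mul_add, Complex.exp_add]

lemma qPow_zero (hbar : ℂ) : qPow hbar 0 = 1 := by simp [qPow]

lemma qPow_mul_qPow_neg (hbar x : ℂ) : qPow hbar x * qPow hbar (-x) = 1 := by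
  rw [← qPow_add, add_neg_cancel, qPow_zero]

lemma uqOf_kinv_mul_k (T : OSType) (n : ℕ) (hbar : ℂ) (a : Fin n) :
    uqOf T n hbar (.kinv a) * uqOf T n hbar (.k a) = 1 := by
  simpa [uqOf] using RingQuot.mkAlgHom_rel ℂ (UqRel.kinv_k (T := T) (hbar := hbar) a)

/-- `q^{-h_α} f_β = q^{(α, β)} f_β q^{-h_α}`. -/
lemma uqOf_kinv_mul_f (T : OSType) (n : ℕ) (hbar : ℂ) (a b : Fin n) :
    uqOf T n hbar (.kinv a) * uqOf T n hbar (.f b) =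
      qPow hbar (intPair (simpleRoot T n a) (simpleRoot T n b)) •
        (uqOf T n hbar (.f b) * uqOf T n hbar (.kinv a)) := by
  have h : uqOf T n hbar (.k a) * uqOf T n hbar (.f b) * uqOf T n hbar (.kinv a) =
      qPow hbar (-(intPair (simpleRoot T n a) (simpleRoot T n b) : ℂ)) •
        uqOf T n hbar (.f b) := by
    simpa [uqOf] using RingQuot.mkAlgHom_rel ℂ (UqRel.k_f (T := T) (hbar := hbar) a b)
  have h2 := congrArg (fun x => uqOf T n hbar (.kinv a) * x) h
  simp only [← mul_assoc, uqOf_kinv_mul_k, one_mul, mul_smul_comm] at h2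
  rw [h2, smul_smul, qPow_mul_qPow_neg, one_smul]

lemma verma_smul_smul {T : OSType} {n : ℕ} {hbar : ℂ} {lam : Fin n → ℂ} (c d : ℂ)
    (v : Verma T n hbar lam) : c • d • v = (c * d) • v :=
  (mul_smul c d v).symm

lemma verma_algebraMap_smul {T : OSType} {n : ℕ} {hbar : ℂ} {lam : Fin n → ℂ} (c : ℂ)
    (v : Verma T n hbar lam) : algebraMap ℂ (Uq T n hbar) c • v = c • v := by
  rw [Algebra.algebraMap_eq_smul_one, smul_assoc, one_smul]

/-- The ideal prescribes only the action of `k a`; applying its inverse to that relation gives this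
one. -/
lemma uqOf_kinv_smul_vermaVec (T : OSType) (n : ℕ) (hbar : ℂ) (lam : Fin n → ℂ) (a : Fin n) :
    uqOf T n hbar (.kinv a) • vermaVec T n hbar lam =
      qPow hbar (-wtPair lam (simpleRoot T n a)) • vermaVec T n hbar lam := by
  have h : uqOf T n hbar (.k a) • vermaVec T n hbar lam =
      qPow hbar (wtPair lam (simpleRoot T n a)) • vermaVec T n hbar lam := by
    rw [← verma_algebraMap_smul, vermaVec, ← Submodule.Quotient.mk_smul,
      ← Submodule.Quotient.mk_smul, smul_eq_mul, smul_eq_mul, mul_one, mul_one,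
      Submodule.Quotient.eq]
    exact Submodule.subset_span (Or.inr ⟨a, rfl⟩)
  have h2 := congrArg (fun x => uqOf T n hbar (.kinv a) • x) h
  simp only [← mul_smul, uqOf_kinv_mul_k, one_smul] at h2
  rw [smul_comm] at h2
  conv_rhs => rw [h2]
  rw [verma_smul_smul, mul_comm, qPow_mul_qPow_neg]
  exact (one_smul ℂ (uqOf T n hbar (.kinv a) • vermaVec T n hbar lam)).symm

lemma uqMonomial_nil (T : OSType) (n : ℕ) (hbar : ℂ) : uqMonomial T n hbar [] = 1 := rfl

lemma uqMonomial_cons (T : OSType) (n : ℕ) (hbar : ℂ) (a : Fin n) (l : List (Fin n)) :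
    uqMonomial T n hbar (a :: l) = uqOf T n hbar (.f a) * uqMonomial T n hbar l := by
  simp [uqMonomial]

lemma uqOf_kinv_smul_uqMonomial_smul_vermaVec (T : OSType) (n : ℕ) (hbar : ℂ) (lam : Fin n → ℂ)
    (a : Fin n) (l : List (Fin n)) :
    uqOf T n hbar (.kinv a) • uqMonomial T n hbar l • vermaVec T n hbar lam =
      qPow hbar ((intPair (simpleRoot T n a) (l.map (simpleRoot T n)).sum : ℂ) -
        wtPair lam (simpleRoot T n a)) • uqMonomial T n hbar l • vermaVec T n hbar lam := by
  induction l with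
  | nil =>
    simp [uqMonomial_nil, uqOf_kinv_smul_vermaVec, intPair]
  | cons b l ih =>
    rw [uqMonomial_cons, mul_smul, ← mul_smul, uqOf_kinv_mul_f, smul_assoc, mul_smul, ih,
      smul_comm (uqOf T n hbar (.f b)), verma_smul_smul, ← qPow_add, List.map_cons, List.sum_cons,
      intPair_add]
    congr 2
    push_cast
    ring

/-! ### The standard filtration -/

lemma tensorGen_mem_stdFiltration {T : OSType} {n : ℕ} {hbar : ℂ} {lam : Fin n → ℂ} {m : ℕ}
    (x : UqGen n) {y : (Fin (T.dim n) → ℂ) ⊗[ℂ] Verma T n hbar lam}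
    (hy : y ∈ stdFiltration T n hbar lam m) :
    tensorGen T n hbar lam x y ∈ stdFiltration T n hbar lam m := by
  suffices h : stdFiltration T n hbar lam m ≤
      (stdFiltration T n hbar lam m).comap (tensorGen T n hbar lam x) from h hy
  refine Submodule.span_le.2 ?_
  rintro _ ⟨z, k, hk, rfl⟩
  refine Submodule.subset_span ⟨FreeAlgebra.ι ℂ x * z, k, hk, ?_⟩
  simp [tensorAct]

lemma natVec_tmul_vermaVec_mem_stdFiltration {T : OSType} {n : ℕ} (hbar : ℂ) (lam : Fin n → ℂ)
    {m : ℕ} {k : Fin (T.dim n)} (hk : k.val < m) :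
    natVec T n k ⊗ₜ[ℂ] vermaVec T n hbar lam ∈ stdFiltration T n hbar lam m :=
  Submodule.subset_span ⟨1, k, hk, by simp⟩

/-- The coproduct formula for `f_a`, solved for its second summand; the scalar is the eigenvalue of
q^{-h_a} on the weight vector ψ v_λ. -/
lemma tmul_f_smul_uqMonomial (T : OSType) (n : ℕ) (hbar : ℂ) (lam : Fin n → ℂ) (a : Fin n)
    (l : List (Fin n)) (w : Fin (T.dim n) → ℂ) :
    w ⊗ₜ[ℂ] (uqMonomial T n hbar (a :: l) • vermaVec T n hbar lam) =
      tensorGen T n hbar lam (.f a) (w ⊗ₜ[ℂ] (uqMonomial T n hbar l • vermaVec T n hbar lam)) -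
        qPow hbar ((intPair (simpleRoot T n a) (l.map (simpleRoot T n)).sum : ℂ) -
          wtPair lam (simpleRoot T n a)) •
          (natAct T n hbar (.f a) w ⊗ₜ[ℂ]
            (uqMonomial T n hbar l • vermaVec T n hbar lam)) := by
  rw [← TensorProduct.tmul_smul, ← uqOf_kinv_smul_uqMonomial_smul_vermaVec, uqMonomial_cons,
    mul_smul]
  simp [tensorGen, vermaAct]

/-- Induction on the word. Dropping `a` while keeping `i` only strengthens the inequality, as α_a
has positive height; replacing w_i by f_a w_i lowers both sides equally. For the empty word the
inequality says that `i` precedes `j`. -/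
lemma natVec_tmul_uqMonomial_mem_stdFiltration {T : OSType} {n : ℕ} (hn : T.IsSimpleRank n)
    (hbar : ℂ) (lam : Fin n → ℂ) (j : Fin (T.dim n)) (l : List (Fin n)) :
    ∀ i : Fin (T.dim n),
      heightFunctional n (wtEps T n j) + heightFunctional n (l.map (simpleRoot T n)).sum <
        heightFunctional n (wtEps T n i) →
      natVec T n i ⊗ₜ[ℂ] (uqMonomial T n hbar l • vermaVec T n hbar lam) ∈
        stdFiltration T n hbar lam j.val := by
  induction l with
  | nil =>
    intro i h
    rw [uqMonomial_nil, one_smul]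
    refine natVec_tmul_vermaVec_mem_stdFiltration hbar lam ?_
    refine (heightFunctional_wtEps_strictAnti T n).lt_iff_gt.1 ?_
    simpa [heightFunctional, intPair] using h
  | cons a l ih =>
    intro i h
    have hpos := heightFunctional_simpleRoot_pos hn a
    have hadd : heightFunctional n ((a :: l).map (simpleRoot T n)).sum =
        heightFunctional n (simpleRoot T n a) +
          heightFunctional n (l.map (simpleRoot T n)).sum := by
      rw [List.map_cons, List.sum_cons, heightFunctional, intPair_add]; rfl
    rw [tmul_f_smul_uqMonomial]
    refine Submodule.sub_mem _ (tensorGen_mem_stdFiltration _ (ih i (by omega)))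
      (Submodule.smul_mem _ _ ?_)
    rcases natAct_f_natVec T n hbar a i with h0 | ⟨r, hr, hw⟩
    · rw [h0, TensorProduct.zero_tmul]
      exact Submodule.zero_mem _
    · rw [hr]
      have hi : heightFunctional n (wtEps T n i) =
          heightFunctional n (simpleRoot T n a) + heightFunctional n (wtEps T n r) := by
        rw [hw, heightFunctional, intPair_add]; rfl
      exact ih r (by omega)

/-! ### The exponent of q along a path, and the main induction -/

lemma thetaExp_self (T : OSType) (n : ℕ) (lam : Fin n → ℂ) (j : Fin (T.dim n)) :
    thetaExp T n lam j j = 0 := by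
  simp [thetaExp, wtPair, intPair]

/-- With β = ε_r - ε_j, expanding ‖α + β‖²/2 yields (α, α)/2, which cancels (ρ, α), and the cross
term (α, β). -/
lemma thetaExp_eq_add {T : OSType} {n : ℕ} (hn : T.IsSimpleRank n) (lam : Fin n → ℂ)
    {a : Fin n} {i r j : Fin (T.dim n)} (h : wtEps T n i = simpleRoot T n a + wtEps T n r) :
    thetaExp T n lam i j = wtPair lam (simpleRoot T n a) -
      (intPair (simpleRoot T n a) (wtEps T n r - wtEps T n j) : ℂ) + thetaExp T n lam r j := by
  have hsq : ∀ α β : Fin n → ℤ, intPair (α + β) (α + β) =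
      intPair α α + 2 * intPair α β + intPair β β := by
    intro α β
    rw [intPair_add, intPair_comm _ α, intPair_comm _ β, intPair_add, intPair_add,
      intPair_comm β α]
    ring
  rw [thetaExp, thetaExp, h, add_sub_assoc, wtPair_add, hsq, wtPair_add_left lam,
    wtPair_weylVector_simpleRoot hn]
  push_cast
  ring

theorem mainTheorem4 (T : OSType) (n : ℕ) (hn : T.IsSimpleRank n)
    (hbar : ℂ) (hq : ∀ m : ℕ, 0 < m → qPow hbar 1 ^ m ≠ 1)
    (lam : Fin n → ℂ) (i j : Fin (T.dim n)) (hij : IsPrec T n hbar i j)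
    (l : List (Fin n)) (hl : IsChevalleyPath T n hbar l i j) :
    natVec T n i ⊗ₜ[ℂ] (uqMonomial T n hbar l.reverse • vermaVec T n hbar lam) -
        ((-1 : ℂ) ^ l.length * qPow hbar (-thetaExp T n lam i j)) •
          (natVec T n j ⊗ₜ[ℂ] vermaVec T n hbar lam) ∈
      stdFiltration T n hbar lam j.val := by
  clear hij hq
  induction l using List.reverseRecOn generalizing i with
  | nil =>
    rw [isChevalleyPath_nil hl, thetaExp_self]
    simp [qPow_zero, uqMonomial_nil]
  | append_singleton l a ih =>
    obtain ⟨r, hr, hw, hp⟩ := isChevalleyPath_append_singleton hl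
    have hsum : (l.reverse.map (simpleRoot T n)).sum = wtEps T n r - wtEps T n j := by
      rw [wtEps_eq_of_isChevalleyPath l hp, List.map_reverse, List.sum_reverse]
      abel
    -- The word has weight ε_r - ε_j, so the inequality needed is that ε_r has smaller height than
    -- ε_i = ε_r + α_a.
    have hmem := natVec_tmul_uqMonomial_mem_stdFiltration hn hbar lam j l.reverse i (by
      have hpos := heightFunctional_simpleRoot_pos hn a
      rw [hsum, hw]
      simp only [heightFunctional, intPair_add, intPair_sub] at hpos ⊢
      omega)
    have hq : qPow hbar (-thetaExp T n lam i j) =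
        qPow hbar ((intPair (simpleRoot T n a) (wtEps T n r - wtEps T n j) : ℂ) -
          wtPair lam (simpleRoot T n a)) * qPow hbar (-thetaExp T n lam r j) := by
      rw [← qPow_add, thetaExp_eq_add hn lam hw]
      congr 1
      ring
    rw [List.reverse_append, List.reverse_singleton, List.singleton_append,
      tmul_f_smul_uqMonomial, hr, hsum, hq, List.length_append, List.length_singleton]
    -- Both terms lie in V_{j-1}: the Δ(f_a)-image of a member, and the induction hypothesis scaled
    -- by the eigenvalue of q^{-h_a}. The subtraction supplies the new sign.
    have := Submodule.sub_mem _ (tensorGen_mem_stdFiltration (.f a) hmem)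
      (Submodule.smul_mem _ (qPow hbar ((intPair (simpleRoot T n a)
        (wtEps T n r - wtEps T n j) : ℂ) - wtPair lam (simpleRoot T n a))) (ih r hp))
    convert this using 1
    rw [smul_sub, smul_smul, pow_succ]
    module
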